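/- Let $(\Omega,\mathcal F,\mathbb P)$ be an atomless probability space, $L^1$ the space of random variables with finite mean, and $\underline L^1\subseteq L^1$ the set of those that are essentially bounded from below. For $\alpha\in[0,1]$ let $\mathrm{VaR}_\alpha(X)=\inf\{x\in\mathbb R:\mathbb P(X\le x)\ge\alpha\}$ (with $\inf\emptyset=\infty$), and for $X\in L^1$ let $\mathrm{ES}_\alpha(X)=\frac1{1-\alpha}\int_\alpha^1\mathrm{VaR}_\beta(X)\,\mathrm d\beta$ if $\alpha<1$ and $\mathrm{ES}_1(X)=\mathrm{VaR}_1(X)$. For a (weakly) decreasing function $\Lambda:\mathbb R\to[0,1]$ and $X\in L^1$ let $$\mathrm{VaR}_\Lambda(X)=\inf\{x\in\mathbb R:\mathbb P(X\le x)\ge\Lambda(x)\},\qquad \mathrm{VaR}^+_\Lambda(X)=\inf\{x\in\mathbb R:\mathbb P(X\le x)>\Lambda(x)\},$$ $$\mathrm{ES}_\Lambda(X)=\sup_{x\in\mathbb R}\min\{\mathrm{ES}_{\Lambda(x)}(X),x\},$$ all with values in $[-\infty,\infty]$. For $\mathcal X\in\{L^1,\underline L^1\}$, a map $\rho:\mathcal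 X\to[-\infty,\infty]$ is quasi-convex if $\rho(\gamma X+(1-\gamma)Y)\le\max\{\rho(X),\rho(Y)\}$ for all $X,Y\in\mathcal X$ and $\gamma\in[0,1]$; it is law invariant if $\rho(X)=\rho(Y)$ whenever $X,Y\in\mathcal X$ have the same distribution; and $\rho\ge\tau$ means $\rho(X)\ge\tau(X)$ for all $X\in\mathcal X$. The following statements hold. (i) For every decreasing $\Lambda:\mathbb R\to(0,1]$, $\mathrm{ES}_\Lambda$ is the pointwise smallest quasi-convex and law-invariant map $\rho:L^1\to[-\infty,\infty]$ with $\rho\ge\mathrm{VaR}_\Lambda$; in particular, it is itself such a map. (ii) For every decreasing $\Lambda:\mathbb R\to(0,1)$, $\mathrm{ES}_\Lambda$ is the pointwise smallest quasi-convex and law-invariant map $\rho:L^1\to[-\infty,\infty]$ with $\rho\ge\mathrm{VaR}^+_\Lambda$; in particular, it is itself such a map. (iii) For every decreasing $\Lambda:\mathbb R\to[0,1)$, $\mathrm{ES}_\Lambda$ (restricted to $\underline L^1$) is the pointwise smallest quasi-convex and law-invariant map $\rho:\underline L^1\to[-\infty,\infty]$ with $\rho\ge\mathrm{VaR}^+_\Lambda$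 on $\underline L^1$; in particular, it is itself such a map. Moreover, for every decreasing $\Lambda:\mathbb R\to[0,1]$ and every $X\in L^1$, $$\mathrm{ES}_\Lambda(X)=\inf_{x\in\mathbb R}\max\{\mathrm{ES}_{\Lambda(x)}(X),x\}.$$ -/

import Mathlib

open MeasureTheory Set

noncomputable section

namespace LambdaES

variable {Ω : Type*} [MeasurableSpace Ω]

/-- The measure `P` is atomless: every event of positive measure contains an event of strictly
smaller positive measure. (Mathlib's `NoAtoms` only speaks about singletons.) -/
def Atomless (P : Measure Ω) : Prop :=
  ∀ A : Set Ω, MeasurableSet A → 0 < P A →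
    ∃ B : Set Ω, MeasurableSet B ∧ B ⊆ A ∧ 0 < P B ∧ P B < P A

/-- `L¹`: the random variables with finite mean. -/
def L1 (P : Measure Ω) : Set (Ω → ℝ) := {X | Measurable X ∧ Integrable X P}

/-- The random variables with finite mean that are essentially bounded from below. -/
def L1Below (P : Measure Ω) : Set (Ω → ℝ) :=
  {X | X ∈ L1 P ∧ ∃ c : ℝ, ∀ᵐ ω ∂P, c ≤ X ω}

/-- The left quantile `VaR_α(X) = inf {x ∈ ℝ : P(X ≤ x) ≥ α}`, the infimum being taken in the
extended reals (so it is `⊤` for the empty set). -/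
def VaR (P : Measure Ω) (α : ℝ) (X : Ω → ℝ) : EReal :=
  sInf ((fun x : ℝ => (x : EReal)) '' {x : ℝ | α ≤ P.real {ω | X ω ≤ x}})

/-- `VaR_Λ(X) = inf {x ∈ ℝ : P(X ≤ x) ≥ Λ(x)}`, the infimum being taken in the extended reals. -/
def VaRLambda (P : Measure Ω) (Λ : ℝ → ℝ) (X : Ω → ℝ) : EReal :=
  sInf ((fun x : ℝ => (x : EReal)) '' {x : ℝ | Λ x ≤ P.real {ω | X ω ≤ x}})

/-- `VaR⁺_Λ(X) = inf {x ∈ ℝ : P(X ≤ x) > Λ(x)}`, the infimum being taken in the extended reals. -/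
def VaRPlusLambda (P : Measure Ω) (Λ : ℝ → ℝ) (X : Ω → ℝ) : EReal :=
  sInf ((fun x : ℝ => (x : EReal)) '' {x : ℝ | Λ x < P.real {ω | X ω ≤ x}})

open Classical in
/-- The Expected Shortfall at level `α ∈ [0,1]`: `(1/(1-α)) ∫_α^1 VaR_β(X) dβ` for `α < 1`, and
`VaR_1(X)` for `α = 1`. For `β ∈ (0,1)` the number `VaR_β(X)` is finite, and `β ↦ VaR_β(X)` is
integrable over `(0,1)` when `X ∈ L¹`, so the real integral is the intended one on `L¹`. -/
def ES (P : Measure Ω) (α : ℝ) (X : Ω → ℝ) : EReal :=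
  if α = 1 then VaR P 1 X
  else ((1 / (1 - α) * ∫ β in α..1, (VaR P β X).toReal : ℝ) : EReal)

/-- `ES_Λ(X) = sup_{x ∈ ℝ} (ES_{Λ(x)}(X) ∧ x)`. -/
def ESLambda (P : Measure Ω) (Λ : ℝ → ℝ) (X : Ω → ℝ) : EReal :=
  ⨆ x : ℝ, min (ES P (Λ x) X) (x : EReal)

/-- Quasi-convexity of a risk measure `ρ` on a set `𝒳` of random variables. (The membership
premise always holds for the convex sets `L1 P` and `L1Below P`, see `convex_L1` and
`convex_L1Below`.) -/
def QuasiConvex {𝒳 : Set (Ω → ℝ)} (ρ : 𝒳 → EReal) : Prop :=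
  ∀ (X Y : 𝒳) (γ : ℝ), 0 ≤ γ → γ ≤ 1 →
    ∀ h : γ • (X : Ω → ℝ) + (1 - γ) • (Y : Ω → ℝ) ∈ 𝒳,
      ρ ⟨γ • (X : Ω → ℝ) + (1 - γ) • (Y : Ω → ℝ), h⟩ ≤ max (ρ X) (ρ Y)

/-- Law invariance of a risk measure `ρ` on a set `𝒳` of random variables: `ρ` takes the same
value on random variables with the same distribution under `P`. -/
def LawInvariant (P : Measure Ω) {𝒳 : Set (Ω → ℝ)} (ρ : 𝒳 → EReal) : Prop :=
  ∀ X Y : 𝒳, P.map (X : Ω → ℝ) = P.map (Y : Ω → ℝ) → ρ X = ρ Y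

/-- The risk measures `𝒳 → [-∞, ∞]` that are quasi-convex, law invariant, and dominate `τ`
pointwise on `𝒳`. -/
def DominatingRiskMeasures (P : Measure Ω) (𝒳 : Set (Ω → ℝ)) (τ : (Ω → ℝ) → EReal) :
    Set (𝒳 → EReal) :=
  {ρ | (∀ X : 𝒳, τ X ≤ ρ X) ∧ QuasiConvex ρ ∧ LawInvariant P ρ}

theorem convex_L1 (P : Measure Ω) : Convex ℝ (L1 P) := by
  intro X hX Y hY a b _ _ _
  exact ⟨(hX.1.const_smul a).add (hY.1.const_smul b), (hX.2.smul a).add (hY.2.smul b)⟩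

theorem convex_L1Below (P : Measure Ω) : Convex ℝ (L1Below P) := by
  intro X hX Y hY a b ha hb hab
  refine ⟨convex_L1 P hX.1 hY.1 ha hb hab, ?_⟩
  obtain ⟨c, hc⟩ := hX.2
  obtain ⟨d, hd⟩ := hY.2
  refine ⟨a * c + b * d, ?_⟩
  filter_upwards [hc, hd] with ω h1 h2
  simp only [Pi.add_apply, Pi.smul_apply, smul_eq_mul]
  gcongr

end LambdaES

end

/-! Minimality rests on averaging: a quasi-convex law-invariant `ρ` satisfies `ρ Z ≤ ρ X` whenever
`Z` is an average of finitely many copies of `X`. If `z < ES_Λ(X)`, some `x > z` has `z <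
ES_{Λ(x)}(X)`. It suffices to find such a `Z` with `P(Z ≤ z)` at most `Λ(x)` (strictly less for
`VaR_Λ`): since `Λ` decreases, the generalized quantile of `Z` is then at least `z`, whence `z ≤ ρ Z
≤ ρ X`.

The averages come from `exists_average_measureReal_le`. With `U` uniform, the copies are
`q(S_i(U))`, where `q` is the quantile function of `X` and `S_i` rotates `(α, 1]` by `i/n` of its
length, fixing `(0, α]`. On `{U > α}` the `n` rotated points occupy each of `n` equal cells once, so
the average of the copies is nearly the mean of `q` over `(α, 1]`, which is `ES_α(X)`. This needs
`q` bounded below on `(α, 1)`: automatic for `α > 0`, and the reason for essential lower bounds when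
`Λ` may vanish.

That `ES_Λ` is itself admissible follows from quasi-convexity of each `ES_α`, via the
Rockafellar–Uryasev formula, and from `ES_α(X) ≥ x` when `P(X ≤ x) ≤ α < 1`. The inf-max formula
uses only that `x ↦ ES_{Λ(x)}(X)` decreases. -/

noncomputable section

namespace LambdaES

/-! ### Chains of events and uniform variables on atomless spaces -/

section Uniform

variable {Ω : Type*} [MeasurableSpace Ω] {P : Measure Ω}

/-- The measure of a union of an a.e. increasing sequence is at most any common bound. -/
theorem measure_iUnion_le_of_ae_mono {A : ℕ → Set Ω} {s : ENNReal}
    (hA : ∀ i j, i ≤ j → A i ≤ᵐ[P] A j) (hs : ∀ n, P (A n) ≤ s) : P (⋃ n, A n) ≤ s := by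
  rw [measure_iUnion_eq_iSup_accumulate]
  refine iSup_le fun n => le_trans (measure_mono_ae ?_) (hs n)
  rw [ae_le_set]
  have : accumulate A n \ A n ⊆ ⋃ i, ⋃ (_ : i ≤ n), (A i \ A n) := by
    intro ω hω
    obtain ⟨h1, h2⟩ := hω
    rw [mem_accumulate] at h1
    obtain ⟨i, hi, h⟩ := h1
    simp only [mem_iUnion]
    exact ⟨i, hi, h, h2⟩
  refine measure_mono_null this ?_
  rw [measure_iUnion_null_iff]
  intro i
  rw [measure_iUnion_null_iff]
  exact fun hi => ae_le_set.1 (hA i n hi)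

theorem ae_le_of_subset {A B : Set Ω} (h : A ⊆ B) : A ≤ᵐ[P] B :=
  ae_le_set.2 (by rw [sdiff_eq_empty.2 h, measure_empty])

theorem ae_le_of_measure_le [IsFiniteMeasure P] {A B : Set Ω}
    (hB : MeasurableSet B) (hc : A ≤ᵐ[P] B ∨ B ≤ᵐ[P] A) (h : P A ≤ P B) : A ≤ᵐ[P] B := by
  rcases hc with hc | hc
  · exact hc
  · exact (ae_eq_of_ae_subset_of_measure_ge hc h hB.nullMeasurableSet (measure_ne_top _ _)).symm.le

/-- An atomless probability space carries a family of events that is totally ordered modulo null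
sets and contains events of every probability. -/
theorem exists_chain_of_atomless [IsProbabilityMeasure P] (hP : Atomless P) :
    ∃ C : Set (Set Ω), (∀ A ∈ C, MeasurableSet A) ∧
      (∀ A ∈ C, ∀ B ∈ C, P A ≤ P B → A ≤ᵐ[P] B) ∧ ∀ s : ENNReal, s ≤ 1 → ∃ A ∈ C, P A = s := by
  let r : {A : Set Ω // MeasurableSet A} → {A : Set Ω // MeasurableSet A} → Prop :=
    fun A B => A.1 ≤ᵐ[P] B.1
  -- Maximality makes `M` contain every event a.e. comparable to all its members; this closes it
  -- under the limits used below.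
  obtain ⟨M, hM, -⟩ := (IsChain.empty : IsChain r ∅).exists_maxChain
  have hmem : ∀ A, (∀ B ∈ M, r A B ∨ r B A) → A ∈ M := by
    intro A hA
    have := hM.2 (hM.1.insert fun B hB _ => hA B hB) (subset_insert A M)
    rw [this]
    exact mem_insert A M
  have hle : ∀ A ∈ M, ∀ B ∈ M, P A.1 ≤ P B.1 → A.1 ≤ᵐ[P] B.1 := by
    intro A hA B hB h
    rcases eq_or_ne A B with rfl | hne
    · exact Filter.EventuallyLE.refl _ _
    · exact ae_le_of_measure_le B.2 (hM.1 hA hB hne) h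
  have htot : ∀ A ∈ M, ∀ B ∈ M, r A B ∨ r B A := by
    intro A hA B hB
    rcases le_total (P A.1) (P B.1) with h | h
    · exact Or.inl (hle A hA B hB h)
    · exact Or.inr (hle B hB A hA h)
  have hempty : (⟨∅, MeasurableSet.empty⟩ : {A : Set Ω // MeasurableSet A}) ∈ M :=
    hmem _ fun B _ => Or.inl (ae_le_of_subset (empty_subset _))
  have huniv : (⟨univ, MeasurableSet.univ⟩ : {A : Set Ω // MeasurableSet A}) ∈ M :=
    hmem _ fun B _ => Or.inr (ae_le_of_subset (subset_univ _))
  refine ⟨Subtype.val '' M, ?_, ?_, ?_⟩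
  · rintro _ ⟨A, -, rfl⟩
    exact A.2
  · rintro _ ⟨A, hA, rfl⟩ _ ⟨B, hB, rfl⟩ h
    exact hle A hA B hB h
  intro s hs
  -- The supremum of probabilities at most `s` is attained, by the union of a maximizing sequence;
  -- `hupp` is the dual with intersections.
  have hlow : ∃ A ∈ M, P A.1 ≤ s ∧ ∀ F ∈ M, P F.1 ≤ s → P F.1 ≤ P A.1 := by
    have hne : ((fun A : {A : Set Ω // MeasurableSet A} => P A.1) '' {A ∈ M | P A.1 ≤ s}).Nonempty :=
      ⟨_, _, ⟨hempty, by simp⟩, rfl⟩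
    obtain ⟨u, hu, hlim, hmemu⟩ := exists_seq_tendsto_sSup hne (OrderTop.bddAbove _)
    choose A hA hAu using hmemu
    have hmono : ∀ i j, i ≤ j → (A i).1 ≤ᵐ[P] (A j).1 := fun i j hij =>
      hle _ (hA i).1 _ (hA j).1 (by simpa [hAu] using hu hij)
    refine ⟨⟨⋃ n, (A n).1, MeasurableSet.iUnion fun n => (A n).2⟩, hmem _ fun B hB => ?_,
      measure_iUnion_le_of_ae_mono hmono fun n => (hA n).2, fun F hF hFs => ?_⟩
    · by_cases h : ∃ n, r B (A n)
      · obtain ⟨n, hn⟩ := h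
        exact Or.inr (hn.trans (ae_le_of_subset (subset_iUnion (fun n => (A n).1) n)))
      · push Not at h
        left
        refine ae_le_set.2 ?_
        simp only [iUnion_sdiff]
        rw [measure_iUnion_null_iff]
        intro n
        exact ae_le_set.1 ((htot _ (hA n).1 B hB).resolve_right (h n))
    · refine le_trans ?_ (le_of_tendsto' hlim fun n => ?_)
      · exact le_sSup ⟨F, ⟨hF, hFs⟩, rfl⟩
      rw [← hAu n]
      exact measure_mono (subset_iUnion (fun n => (A n).1) n)
  have hupp : ∃ B ∈ M, s ≤ P B.1 ∧ ∀ F ∈ M, s ≤ P F.1 → P B.1 ≤ P F.1 := by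
    have hne : ((fun A : {A : Set Ω // MeasurableSet A} => P A.1) '' {A ∈ M | s ≤ P A.1}).Nonempty :=
      ⟨_, _, ⟨huniv, by simpa using hs⟩, rfl⟩
    obtain ⟨u, hu, hlim, hmemu⟩ := exists_seq_tendsto_sInf hne (OrderBot.bddBelow _)
    choose A hA hAu using hmemu
    have hmono : ∀ i j, i ≤ j → (A i).1ᶜ ≤ᵐ[P] (A j).1ᶜ := by
      intro i j hij
      have := hle _ (hA j).1 _ (hA i).1 (by simpa [hAu] using hu hij)
      exact this.compl
    refine ⟨⟨⋂ n, (A n).1, MeasurableSet.iInter fun n => (A n).2⟩, hmem _ fun B hB => ?_, ?_,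
      fun F hF hFs => ?_⟩
    · by_cases h : ∃ n, r (A n) B
      · obtain ⟨n, hn⟩ := h
        exact Or.inl (Filter.EventuallyLE.trans
          (ae_le_of_subset (iInter_subset (fun n => (A n).1) n)) hn)
      · push Not at h
        right
        refine ae_le_set.2 ?_
        simp only [sdiff_iInter]
        rw [measure_iUnion_null_iff]
        intro n
        exact ae_le_set.1 ((htot _ (hA n).1 B hB).resolve_left (h n))
    · have h1 : P (⋃ n, (A n).1ᶜ) ≤ 1 - s := by
        refine measure_iUnion_le_of_ae_mono hmono fun n => ?_
        rw [prob_compl_eq_one_sub (A n).2]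
        exact tsub_le_tsub_left (hA n).2 1
      rw [← compl_iInter, prob_compl_eq_one_sub (MeasurableSet.iInter fun n => (A n).2)] at h1
      exact (ENNReal.sub_le_sub_iff_left hs ENNReal.one_ne_top).1 h1
    · refine le_trans (ge_of_tendsto' hlim fun n => ?_) (sInf_le ⟨F, ⟨hF, hFs⟩, rfl⟩)
      rw [← hAu n]
      exact measure_mono (iInter_subset (fun n => (A n).1) n)
  obtain ⟨A, hA, hAs, hAmax⟩ := hlow
  obtain ⟨B, hB, hBs, hBmin⟩ := hupp
  refine ⟨A.1, ⟨A, hA, rfl⟩, hAs.antisymm ?_⟩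
  by_contra hlt
  push Not at hlt
  have hAB : A.1 ≤ᵐ[P] B.1 := hle A hA B hB (hAs.trans hBs)
  have hPB : P A.1 + P (B.1 \ A.1) = P B.1 := by
    rw [← measure_union disjoint_sdiff_right (B.2.diff A.2), union_sdiff_self]
    refine le_antisymm (measure_mono_ae ?_) (measure_mono subset_union_right)
    have := hAB.union (Filter.EventuallyLE.refl (ae P) B.1)
    rwa [union_self] at this
  have hpos : 0 < P (B.1 \ A.1) := by
    rw [pos_iff_ne_zero]
    intro h0
    rw [h0, add_zero] at hPB
    exact absurd (hBs.trans_eq hPB.symm) (not_le.2 hlt)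
  -- No member of `M` has probability strictly between those of `A` and `B`, yet atomlessness
  -- inserts `A ∪ D` there.
  obtain ⟨D, hD, hDsub, hD0, hD1⟩ := hP _ (B.2.diff A.2) hpos
  have hE : P (A.1 ∪ D) = P A.1 + P D :=
    measure_union (disjoint_sdiff_right.mono_right hDsub) hD
  have hEM : (⟨A.1 ∪ D, A.2.union hD⟩ : {A : Set Ω // MeasurableSet A}) ∈ M := by
    refine hmem _ fun F hF => ?_
    rcases le_total (P F.1) s with h | h
    · exact Or.inr ((hle F hF A hA (hAmax F hF h)).trans
        (ae_le_of_subset subset_union_left))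
    · left
      have h1 : (A.1 ∪ D : Set Ω) ≤ᵐ[P] B.1 := by
        have := hAB.union (ae_le_of_subset (P := P) (hDsub.trans sdiff_subset))
        rwa [union_self] at this
      exact h1.trans (hle B hB F hF (hBmin F hF h))
  rcases le_total (P (A.1 ∪ D)) s with h | h
  · have := hAmax _ hEM h
    simp only [hE] at this
    exact absurd this (not_le.2 (ENNReal.lt_add_right (measure_ne_top _ _) hD0.ne'))
  · have := hBmin _ hEM h
    simp only [hE, ← hPB] at this
    exact absurd this (not_le.2 ((ENNReal.add_lt_add_iff_left (measure_ne_top _ _)).2 hD1))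

/-- An atomless probability space carries a uniformly distributed random variable. -/
theorem exists_uniform [IsProbabilityMeasure P] (hP : Atomless P) :
    ∃ U : Ω → ℝ, Measurable U ∧ P.map U = volume.restrict (Ioc (0 : ℝ) 1) := by
  classical
  obtain ⟨C, hCm, hCle, hC⟩ := exists_chain_of_atomless hP
  have : ∀ q : ℚ, ∃ A ∈ C, (q : ℝ) ∈ Icc (0 : ℝ) 1 → P A = ENNReal.ofReal q := by
    intro q
    by_cases hq : (q : ℝ) ∈ Icc (0 : ℝ) 1
    · obtain ⟨A, hA, h⟩ := hC (ENNReal.ofReal q) (ENNReal.ofReal_le_one.2 hq.2)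
      exact ⟨A, hA, fun _ => h⟩
    · obtain ⟨A, hA, -⟩ := hC 0 zero_le_one
      exact ⟨A, hA, fun h => absurd h hq⟩
  choose A hA hPA using this
  -- The infimum over `q` is the first rational level at which `ω` enters the chain; the default
  -- value 1 keeps it in `[0, 1]`.
  let f : ℚ → Ω → ℝ := fun q ω => if (q : ℝ) ∈ Icc (0 : ℝ) 1 ∧ ω ∈ A q then (q : ℝ) else 1
  have hf0 : ∀ q ω, 0 ≤ f q ω := by
    intro q ω
    by_cases h : (q : ℝ) ∈ Icc (0 : ℝ) 1 ∧ ω ∈ A q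
    · simp only [f, if_pos h]
      exact h.1.1
    · simp only [f, if_neg h]
      exact zero_le_one
  have hbdd : ∀ ω, BddBelow (range fun q => f q ω) := fun ω =>
    ⟨0, by rintro _ ⟨q, rfl⟩; exact hf0 q ω⟩
  have hU : Measurable fun ω => ⨅ q, f q ω := by
    refine Measurable.iInf fun q => ?_
    by_cases hq : (q : ℝ) ∈ Icc (0 : ℝ) 1
    · simp only [f, hq, true_and]
      exact Measurable.ite (hCm _ (hA q)) measurable_const measurable_const
    · simp only [f, hq, false_and, if_false]
      exact measurable_const
  refine ⟨fun ω => ⨅ q, f q ω, hU, ?_⟩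
  have hU0 : ∀ ω, 0 ≤ ⨅ q, f q ω := fun ω => le_ciInf fun q => hf0 q ω
  have hU1 : ∀ ω, ⨅ q, f q ω ≤ 1 := by
    intro ω
    refine (ciInf_le (hbdd ω) (2 : ℚ)).trans ?_
    simp [f]
  have hPU : ∀ t : ℝ, 0 < t → t ≤ 1 → P {ω | ⨅ q, f q ω < t} = ENNReal.ofReal t := by
    intro t ht0 ht1
    have hset : {ω | ⨅ q, f q ω < t} =
        ⋃ q : ℚ, ⋃ (_ : (q : ℝ) ∈ Icc (0 : ℝ) 1 ∧ (q : ℝ) < t), A q := by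
      ext ω
      simp only [mem_ofPred_eq, mem_iUnion]
      constructor
      · intro h
        obtain ⟨q, hq⟩ := exists_lt_of_ciInf_lt h
        by_cases hc : (q : ℝ) ∈ Icc (0 : ℝ) 1 ∧ ω ∈ A q
        · simp only [f, if_pos hc] at hq
          exact ⟨q, ⟨hc.1, hq⟩, hc.2⟩
        · simp only [f, if_neg hc] at hq
          exact absurd hq (not_lt.2 ht1)
      · rintro ⟨q, ⟨hq, hqt⟩, hω⟩
        refine (ciInf_le (hbdd ω) q).trans_lt ?_
        simp only [f, if_pos (And.intro hq hω)]
        exact hqt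
    rw [hset]
    refine le_antisymm ?_ ?_
    · obtain ⟨B, hB, hPB⟩ := hC (ENNReal.ofReal t) (ENNReal.ofReal_le_one.2 ht1)
      rw [← hPB]
      refine measure_mono_ae (ae_le_set.2 ?_)
      simp only [iUnion_sdiff]
      rw [measure_iUnion_null_iff]
      intro q
      rw [measure_iUnion_null_iff]
      intro hq
      refine ae_le_set.1 (hCle _ (hA q) _ hB ?_)
      rw [hPB, hPA q hq.1]
      exact ENNReal.ofReal_le_ofReal hq.2.le
    · refine le_of_forall_lt fun c hc => ?_
      have hctop : c ≠ ⊤ := hc.ne_top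
      have hct : c.toReal < t := (ENNReal.lt_ofReal_iff_toReal_lt hctop).1 hc
      obtain ⟨q, hcq, hqt⟩ := exists_rat_btwn hct
      have hq : (q : ℝ) ∈ Icc (0 : ℝ) 1 :=
        ⟨(ENNReal.toReal_nonneg).trans hcq.le, hqt.le.trans ht1⟩
      calc c < ENNReal.ofReal q := (ENNReal.lt_ofReal_iff_toReal_lt hctop).2 hcq
        _ = P (A q) := (hPA q hq).symm
        _ ≤ _ := measure_mono (subset_iUnion₂_of_subset q ⟨hq, hqt⟩ Subset.rfl)
  have := Measure.isProbabilityMeasure_map (μ := P) hU.aemeasurable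
  refine Measure.ext_of_Ici _ _ fun t => ?_
  rw [Measure.map_apply hU measurableSet_Ici, Measure.restrict_apply measurableSet_Ici]
  rcases le_or_gt t 0 with ht | ht
  · have h1 : (fun ω => ⨅ q, f q ω) ⁻¹' Ici t = univ :=
      eq_univ_of_forall fun ω => ht.trans (hU0 ω)
    have h2 : Ici t ∩ Ioc (0 : ℝ) 1 = Ioc 0 1 :=
      inter_eq_right.2 fun x hx => ht.trans hx.1.le
    simp [h1, h2]
  rcases le_or_gt t 1 with ht1 | ht1
  · have h1 : (fun ω => ⨅ q, f q ω) ⁻¹' Ici t = {ω | ⨅ q, f q ω < t}ᶜ := by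
      ext ω
      simp
    have h2 : Ici t ∩ Ioc (0 : ℝ) 1 = Icc t 1 := by
      ext x
      simp only [mem_inter_iff, mem_Ici, mem_Ioc, mem_Icc]
      constructor
      · exact fun h => ⟨h.1, h.2.2⟩
      · exact fun h => ⟨h.1, ht.trans_le h.1, h.2⟩
    rw [h1, h2, prob_compl_eq_one_sub (measurableSet_lt hU measurable_const), hPU t ht ht1, Real.volume_Icc,
      ENNReal.ofReal_sub _ ht.le, ENNReal.ofReal_one]
  · have h1 : (fun ω => ⨅ q, f q ω) ⁻¹' Ici t = ∅ :=
      eq_empty_of_forall_notMem fun ω h => absurd (hU1 ω) (not_le.2 (ht1.trans_le h))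
    have h2 : Ici t ∩ Ioc (0 : ℝ) 1 = ∅ :=
      eq_empty_of_forall_notMem fun x h => absurd h.2.2 (not_le.2 (ht1.trans_le h.1))
    rw [h1, h2, measure_empty, measure_empty]

end Uniform

/-! ### Quantile functions and the Rockafellar–Uryasev formula -/

section Quantile

variable {Ω : Type*} [MeasurableSpace Ω] {P : Measure Ω}

open Filter Topology ProbabilityTheory

/-- The real-valued left quantile function of `X` on `(0, 1)`, extended by zero. -/
def quantile (P : Measure Ω) (X : Ω → ℝ) : ℝ → ℝ :=
  indicator (Ioo 0 1) fun β => (VaR P β X).toReal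

theorem exists_VaR_eq [IsProbabilityMeasure P] {X : Ω → ℝ} (hX : Measurable X) {β : ℝ}
    (hβ : β ∈ Ioo (0 : ℝ) 1) : ∃ m : ℝ, {x : ℝ | β ≤ P.real {ω | X ω ≤ x}} = Ici m ∧ VaR P β X = m := by
  have := Measure.isProbabilityMeasure_map (μ := P) hX.aemeasurable
  set F := cdf (P.map X)
  have hF : ∀ x, P.real {ω | X ω ≤ x} = F x := by
    intro x
    rw [cdf_eq_real, map_measureReal_apply hX measurableSet_Iic]
    rfl
  obtain ⟨a, ha⟩ := ((tendsto_cdf_atBot (P.map X)).eventually_lt_const hβ.1).exists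
  obtain ⟨b, hb⟩ := ((tendsto_cdf_atTop (P.map X)).eventually_const_lt hβ.2).exists
  have hbdd : BddBelow {x : ℝ | β ≤ F x} := by
    refine ⟨a, fun x hx => ?_⟩
    by_contra hlt
    exact absurd (hx.trans (F.mono (not_le.1 hlt).le)) (not_le.2 ha)
  have hne : {x : ℝ | β ≤ F x}.Nonempty := ⟨b, hb.le⟩
  have hgt : ∀ x, sInf {x : ℝ | β ≤ F x} < x → β ≤ F x := by
    intro x hx
    obtain ⟨y, hy, hyx⟩ := exists_lt_of_csInf_lt hne hx
    exact le_trans hy (F.mono hyx.le)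
  -- Right continuity of the distribution function puts the infimum in the set.
  have hmem : β ≤ F (sInf {x : ℝ | β ≤ F x}) := by
    have h := (F.right_continuous (sInf {x : ℝ | β ≤ F x})).tendsto.mono_left
      (nhdsWithin_mono _ Ioi_subset_Ici_self)
    refine ge_of_tendsto h ?_
    filter_upwards [self_mem_nhdsWithin] with x hx using hgt x hx
  have hm : {x : ℝ | β ≤ P.real {ω | X ω ≤ x}} = Ici (sInf {x : ℝ | β ≤ F x}) := by
    simp only [hF]
    exact Subset.antisymm (fun x hx => csInf_le hbdd hx) fun x hx => hmem.trans (F.mono hx)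
  refine ⟨_, hm, ?_⟩
  rw [VaR, hm]
  refine IsGLB.sInf_eq (IsLeast.isGLB ⟨⟨_, self_mem_Ici, rfl⟩, ?_⟩)
  rintro _ ⟨x, hx, rfl⟩
  exact EReal.coe_le_coe_iff.2 hx

/-- The Galois connection between quantile and distribution functions, from which monotonicity,
measurability and the law of the quantile function follow. -/
theorem quantile_le_iff [IsProbabilityMeasure P] {X : Ω → ℝ} (hX : Measurable X) {β : ℝ}
    (hβ : β ∈ Ioo (0 : ℝ) 1) {x : ℝ} :
    quantile P X β ≤ x ↔ β ≤ P.real {ω | X ω ≤ x} := by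
  obtain ⟨m, hm, h1⟩ := exists_VaR_eq (P := P) hX hβ
  have h2 : quantile P X β = m := by
    rw [quantile, indicator_of_mem hβ, h1, EReal.toReal_coe]
  rw [h2]
  have : x ∈ {x : ℝ | β ≤ P.real {ω | X ω ≤ x}} ↔ x ∈ Ici m := by rw [hm]
  exact this.symm

theorem monotoneOn_quantile [IsProbabilityMeasure P] {X : Ω → ℝ} (hX : Measurable X) :
    MonotoneOn (quantile P X) (Ioo 0 1) := by
  intro a ha b hb hab
  exact (quantile_le_iff hX ha).2 (hab.trans ((quantile_le_iff hX hb).1 le_rfl))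

theorem measurable_quantile [IsProbabilityMeasure P] {X : Ω → ℝ} (hX : Measurable X) :
    Measurable (quantile P X) := by
  refine measurable_of_Iic fun x => ?_
  have : quantile P X ⁻¹' Iic x =
      (Ioo 0 1 ∩ Iic (P.real {ω | X ω ≤ x})) ∪ ((Ioo 0 1)ᶜ ∩ {_β | 0 ≤ x}) := by
    ext β
    by_cases hβ : β ∈ Ioo (0 : ℝ) 1
    · rw [mem_preimage, mem_Iic, quantile_le_iff hX hβ]
      simp [hβ.1, hβ.2]
    · have h0 : quantile P X β = 0 := indicator_of_notMem hβ _
      rw [mem_preimage, mem_Iic, h0]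
      simp only [mem_union, mem_inter_iff, hβ, false_and, false_or, mem_compl_iff,
        not_false_eq_true, true_and, mem_ofPred_eq]
  rw [this]
  exact (measurableSet_Ioo.inter measurableSet_Iic).union
    (measurableSet_Ioo.compl.inter (MeasurableSet.const _))

/-- The quantile function pushes the uniform distribution to the law of `X`. -/
theorem map_quantile [IsProbabilityMeasure P] {X : Ω → ℝ} (hX : Measurable X) :
    (volume.restrict (Ioc (0 : ℝ) 1)).map (quantile P X) = P.map X := by
  rw [← Measure.restrict_congr_set (Ioo_ae_eq_Ioc (a := (0 : ℝ)) (b := 1) (μ := volume))]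
  have := Measure.isProbabilityMeasure_map (μ := P) hX.aemeasurable
  have : IsFiniteMeasure ((volume.restrict (Ioo (0 : ℝ) 1)).map (quantile P X)) :=
    Measure.isFiniteMeasure_map _ _
  refine Measure.ext_of_Iic _ _ fun x => ?_
  rw [Measure.map_apply (measurable_quantile hX) measurableSet_Iic,
    Measure.map_apply hX measurableSet_Iic,
    Measure.restrict_apply (measurable_quantile hX measurableSet_Iic)]
  have h1 : quantile P X ⁻¹' Iic x ∩ Ioo 0 1 = Ioo 0 1 ∩ Iic (P.real {ω | X ω ≤ x}) := by
    ext β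
    constructor
    · exact fun h => ⟨h.2, (quantile_le_iff hX h.2).1 h.1⟩
    · exact fun h => ⟨(quantile_le_iff hX h.1).2 h.2, h.1⟩
  have h2 : (Ioo 0 1 ∩ Iic (P.real {ω | X ω ≤ x}) : Set ℝ) =ᵐ[volume]
      (Ioc 0 (P.real {ω | X ω ≤ x}) : Set ℝ) := by
    refine (Ioo_ae_eq_Ioc.inter (ae_eq_refl _)).trans ?_
    rw [Ioc_inter_Iic, min_eq_right measureReal_le_one]
    exact ae_eq_refl _
  rw [h1, measure_congr h2, Real.volume_Ioc, sub_zero, ofReal_measureReal]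
  rfl

theorem integral_comp_quantile [IsProbabilityMeasure P] {X : Ω → ℝ} (hX : Measurable X)
    {g : ℝ → ℝ} (hg : Measurable g) :
    ∫ β in (0 : ℝ)..1, g (quantile P X β) = ∫ ω, g (X ω) ∂P := by
  rw [intervalIntegral.integral_of_le zero_le_one,
    ← integral_map (measurable_quantile hX).aemeasurable hg.aestronglyMeasurable,
    map_quantile hX, integral_map hX.aemeasurable hg.aestronglyMeasurable]

theorem intervalIntegrable_quantile [IsProbabilityMeasure P] {X : Ω → ℝ} (hX : X ∈ L1 P)
    {a b : ℝ} (ha : a ∈ Icc (0 : ℝ) 1) (hb : b ∈ Icc (0 : ℝ) 1) :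
    IntervalIntegrable (quantile P X) volume a b := by
  have h : IntervalIntegrable (quantile P X) volume 0 1 := by
    rw [intervalIntegrable_iff_integrableOn_Ioc_of_le zero_le_one, IntegrableOn]
    have h1 : Integrable id (P.map X) :=
      (integrable_map_measure measurable_id.aestronglyMeasurable hX.1.aemeasurable).2 hX.2
    rw [← map_quantile hX.1] at h1
    exact (integrable_map_measure measurable_id.aestronglyMeasurable
      (measurable_quantile hX.1).aemeasurable).1 h1
  refine h.mono_set ?_
  rw [uIcc_of_le zero_le_one]
  exact uIcc_subset_Icc ha hb

theorem ES_eq [IsProbabilityMeasure P] (X : Ω → ℝ) {α : ℝ} (h0 : 0 ≤ α) (h1 : α < 1) :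
    ES P α X = ((1 / (1 - α) * ∫ β in α..1, quantile P X β : ℝ) : EReal) := by
  rw [ES, if_neg h1.ne]
  congr 2
  rw [intervalIntegral.integral_of_le h1.le, intervalIntegral.integral_of_le h1.le,
    integral_Ioc_eq_integral_Ioo, integral_Ioc_eq_integral_Ioo]
  refine setIntegral_congr_fun measurableSet_Ioo fun β hβ => ?_
  have hβ' : β ∈ Ioo (0 : ℝ) 1 := ⟨h0.trans_lt hβ.1, hβ.2⟩
  simp only [quantile, indicator_of_mem hβ']

theorem intervalIntegrable_positivePart [IsProbabilityMeasure P] {X : Ω → ℝ} (hX : X ∈ L1 P)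
    (t : ℝ) {a b : ℝ} (ha : a ∈ Icc (0 : ℝ) 1) (hb : b ∈ Icc (0 : ℝ) 1) :
    IntervalIntegrable (fun β => max (quantile P X β - t) 0) volume a b := by
  have h := ((intervalIntegrable_quantile hX ha hb).sub (intervalIntegrable_const (c := t)))
  exact ⟨h.1.pos_part, h.2.pos_part⟩

/-- The tail integral of the quantile function is bounded by the Rockafellar–Uryasev functional. -/
theorem integral_quantile_le [IsProbabilityMeasure P] {X : Ω → ℝ} (hX : X ∈ L1 P) {α : ℝ}
    (hα : α ∈ Icc (0 : ℝ) 1) (t : ℝ) :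
    ∫ β in α..1, quantile P X β ≤ (1 - α) * t + ∫ ω, max (X ω - t) 0 ∂P := by
  have m0 : (0 : ℝ) ∈ Icc (0 : ℝ) 1 := ⟨le_rfl, zero_le_one⟩
  have m1 : (1 : ℝ) ∈ Icc (0 : ℝ) 1 := ⟨zero_le_one, le_rfl⟩
  rw [← integral_comp_quantile hX.1 (g := fun x => max (x - t) 0) (by fun_prop),
    ← intervalIntegral.integral_add_adjacent_intervals
      (intervalIntegrable_positivePart hX t m0 hα) (intervalIntegrable_positivePart hX t hα m1)]
  have h1 : 0 ≤ ∫ β in (0 : ℝ)..α, max (quantile P X β - t) 0 :=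
    intervalIntegral.integral_nonneg hα.1 fun _ _ => le_max_right _ _
  have h2 : ∫ β in α..1, (quantile P X β - t) ≤ ∫ β in α..1, max (quantile P X β - t) 0 :=
    intervalIntegral.integral_mono_on hα.2
      ((intervalIntegrable_quantile hX hα m1).sub intervalIntegrable_const)
      (intervalIntegrable_positivePart hX t hα m1) fun _ _ => le_max_left _ _
  rw [intervalIntegral.integral_sub (intervalIntegrable_quantile hX hα m1)
    intervalIntegrable_const, intervalIntegral.integral_const, smul_eq_mul] at h2
  linarith

/-- The Rockafellar–Uryasev bound is attained at the quantile. -/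
theorem integral_quantile_eq [IsProbabilityMeasure P] {X : Ω → ℝ} (hX : X ∈ L1 P) {α : ℝ}
    (hα : α ∈ Ioo (0 : ℝ) 1) :
    ∫ β in α..1, quantile P X β =
      (1 - α) * quantile P X α + ∫ ω, max (X ω - quantile P X α) 0 ∂P := by
  have m0 : (0 : ℝ) ∈ Icc (0 : ℝ) 1 := ⟨le_rfl, zero_le_one⟩
  have m1 : (1 : ℝ) ∈ Icc (0 : ℝ) 1 := ⟨zero_le_one, le_rfl⟩
  have hα' : α ∈ Icc (0 : ℝ) 1 := Ioo_subset_Icc_self hα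
  set t := quantile P X α
  rw [← integral_comp_quantile hX.1 (g := fun x => max (x - t) 0) (by fun_prop),
    ← intervalIntegral.integral_add_adjacent_intervals
      (intervalIntegrable_positivePart hX t m0 hα') (intervalIntegrable_positivePart hX t hα' m1)]
  -- Below `α` the quantile is at most `t` and the excess vanishes; above `α` it is at least `t` and
  -- the positive part can be dropped.
  have h1 : ∫ β in (0 : ℝ)..α, max (quantile P X β - t) 0 = 0 := by
    rw [intervalIntegral.integral_of_le hα.1.le]
    refine setIntegral_eq_zero_of_forall_eq_zero fun β hβ => max_eq_right ?_
    exact sub_nonpos.2 (monotoneOn_quantile hX.1 ⟨hβ.1, hβ.2.trans_lt hα.2⟩ hα hβ.2)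
  have h2 : ∫ β in α..1, max (quantile P X β - t) 0 = ∫ β in α..1, (quantile P X β - t) := by
    rw [intervalIntegral.integral_of_le hα.2.le, intervalIntegral.integral_of_le hα.2.le,
      integral_Ioc_eq_integral_Ioo, integral_Ioc_eq_integral_Ioo]
    refine setIntegral_congr_fun measurableSet_Ioo fun β hβ => max_eq_left ?_
    exact sub_nonneg.2 (monotoneOn_quantile hX.1 hα ⟨hα.1.trans hβ.1, hβ.2⟩ hβ.1.le)
  rw [h1, h2, intervalIntegral.integral_sub (intervalIntegrable_quantile hX hα' m1)
    intervalIntegrable_const, intervalIntegral.integral_const, smul_eq_mul]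
  ring

end Quantile

/-! ### Monotonicity, domination and quasi-convexity of Expected Shortfall -/

section ExpectedShortfall

variable {Ω : Type*} [MeasurableSpace Ω] {P : Measure Ω}

theorem measureReal_le_mono [IsFiniteMeasure P] (X : Ω → ℝ) {x y : ℝ} (h : x ≤ y) :
    P.real {ω | X ω ≤ x} ≤ P.real {ω | X ω ≤ y} :=
  measureReal_mono fun _ hω => le_trans hω h

theorem integral_le_mul_of_le_Ioo {f : ℝ → ℝ} {a b c : ℝ} (hab : a ≤ b)
    (hf : IntervalIntegrable f volume a b) (h : ∀ x ∈ Ioo a b, f x ≤ c) :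
    ∫ x in a..b, f x ≤ (b - a) * c := by
  have := intervalIntegral.integral_mono_on_of_le_Ioo hab hf (intervalIntegrable_const (c := c)) h
  rwa [intervalIntegral.integral_const, smul_eq_mul] at this

theorem mul_le_integral_of_le_Ioo {f : ℝ → ℝ} {a b c : ℝ} (hab : a ≤ b)
    (hf : IntervalIntegrable f volume a b) (h : ∀ x ∈ Ioo a b, c ≤ f x) :
    (b - a) * c ≤ ∫ x in a..b, f x := by
  have := intervalIntegral.integral_mono_on_of_le_Ioo hab (intervalIntegrable_const (c := c)) hf h
  rwa [intervalIntegral.integral_const, smul_eq_mul] at this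

theorem right_mem_unitIcc : (1 : ℝ) ∈ Icc (0 : ℝ) 1 := ⟨zero_le_one, le_rfl⟩

theorem ES_one (X : Ω → ℝ) : ES P 1 X = VaR P 1 X := if_pos rfl

theorem ES_le_VaR_one [IsProbabilityMeasure P] {X : Ω → ℝ} (hX : X ∈ L1 P) {α : ℝ}
    (hα : α ∈ Icc (0 : ℝ) 1) : ES P α X ≤ VaR P 1 X := by
  rcases hα.2.eq_or_lt with rfl | h1
  · exact (ES_one X).le
  rw [ES_eq X hα.1 h1]
  refine le_sInf ?_
  rintro _ ⟨x, hx, rfl⟩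
  rw [EReal.coe_le_coe_iff, one_div, inv_mul_le_iff₀ (sub_pos.2 h1)]
  refine integral_le_mul_of_le_Ioo h1.le (intervalIntegrable_quantile hX hα right_mem_unitIcc)
    fun β hβ => ?_
  exact (quantile_le_iff hX.1 ⟨hα.1.trans_lt hβ.1, hβ.2⟩).2 (hβ.2.le.trans hx)

/-- For levels below 1, the threshold `t = quantile P X α'` serves both: it is optimal for `α'` and
gives an upper bound for `α`, and `t + E[(X - t)⁺] / (1 - α)` increases in `α`. -/
theorem ES_mono [IsProbabilityMeasure P] {X : Ω → ℝ} (hX : X ∈ L1 P) {α α' : ℝ}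
    (h0 : 0 ≤ α) (h : α ≤ α') (h1 : α' ≤ 1) : ES P α X ≤ ES P α' X := by
  rcases h.eq_or_lt with rfl | h
  · exact le_rfl
  rcases h1.eq_or_lt with rfl | h1
  · rw [ES_one]
    exact ES_le_VaR_one hX ⟨h0, h.le⟩
  rw [ES_eq X h0 (h.trans h1), ES_eq X (h0.trans h.le) h1, EReal.coe_le_coe_iff,
    integral_quantile_eq hX ⟨h0.trans_lt h, h1⟩]
  have hle := integral_quantile_le hX ⟨h0, h.le.trans h1.le⟩ (quantile P X α')
  set t := quantile P X α'
  have hE : 0 ≤ ∫ ω, max (X ω - t) 0 ∂P := integral_nonneg fun _ => le_max_right _ _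
  set E := ∫ ω, max (X ω - t) 0 ∂P
  have p1 : 0 < 1 - α := by linarith
  have p2 : 0 < 1 - α' := by linarith
  calc 1 / (1 - α) * ∫ β in α..1, quantile P X β ≤ 1 / (1 - α) * ((1 - α) * t + E) := by gcongr
    _ = t + 1 / (1 - α) * E := by field_simp
    _ ≤ t + 1 / (1 - α') * E := by gcongr
    _ = 1 / (1 - α') * ((1 - α') * t + E) := by field_simp

theorem le_ES_of_measureReal_le [IsProbabilityMeasure P] {X : Ω → ℝ} (hX : X ∈ L1 P) {α x : ℝ}
    (h0 : 0 ≤ α) (h1 : α < 1) (h : P.real {ω | X ω ≤ x} ≤ α) : (x : EReal) ≤ ES P α X := by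
  rw [ES_eq X h0 h1, EReal.coe_le_coe_iff, one_div, le_inv_mul_iff₀ (sub_pos.2 h1)]
  refine mul_le_integral_of_le_Ioo h1.le
    (intervalIntegrable_quantile hX ⟨h0, h1.le⟩ right_mem_unitIcc) fun β hβ => ?_
  by_contra hlt
  have := (quantile_le_iff hX.1 ⟨h0.trans_lt hβ.1, hβ.2⟩).1 (not_le.1 hlt).le
  exact absurd (this.trans h) (not_le.2 hβ.1)

theorem VaRPlusLambda_le_ESLambda [IsProbabilityMeasure P] {Λ : ℝ → ℝ}
    (hΛ : ∀ x, Λ x ∈ Ico (0 : ℝ) 1) {X : Ω → ℝ} (hX : X ∈ L1 P) :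
    VaRPlusLambda P Λ X ≤ ESLambda P Λ X := by
  refine EReal.ge_of_forall_gt_iff_ge.1 fun z hz => ?_
  have hzΛ : P.real {ω | X ω ≤ z} ≤ Λ z := by
    by_contra hlt
    have hle : VaRPlusLambda P Λ X ≤ z := sInf_le ⟨z, not_le.1 hlt, rfl⟩
    exact absurd hle (not_le.2 hz)
  exact le_iSup_of_le z (le_min (le_ES_of_measureReal_le hX (hΛ z).1 (hΛ z).2 hzΛ) le_rfl)

theorem VaRLambda_le_ESLambda [IsProbabilityMeasure P] {Λ : ℝ → ℝ}
    (hΛ : ∀ x, Λ x ∈ Icc (0 : ℝ) 1) {X : Ω → ℝ} (hX : X ∈ L1 P) :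
    VaRLambda P Λ X ≤ ESLambda P Λ X := by
  refine EReal.ge_of_forall_gt_iff_ge.1 fun z hz => ?_
  have hzΛ : P.real {ω | X ω ≤ z} < Λ z := by
    by_contra hlt
    have hle : VaRLambda P Λ X ≤ z := sInf_le ⟨z, not_lt.1 hlt, rfl⟩
    exact absurd hle (not_le.2 hz)
  refine le_iSup_of_le z (le_min ?_ le_rfl)
  rcases (hΛ z).2.eq_or_lt with h1 | h1
  · rw [h1] at hzΛ ⊢
    rw [ES_one]
    refine le_sInf ?_
    rintro _ ⟨x, hx, rfl⟩
    rw [EReal.coe_le_coe_iff]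
    by_contra hlt
    exact absurd (le_trans hx (measureReal_le_mono X (not_le.1 hlt).le)) (not_le.2 hzΛ)
  · exact le_ES_of_measureReal_le hX (hΛ z).1 h1 hzΛ.le

theorem ES_congr_of_map_eq {X Y : Ω → ℝ} (hX : Measurable X) (hY : Measurable Y)
    (h : P.map X = P.map Y) (α : ℝ) : ES P α X = ES P α Y := by
  have hF : ∀ x, P.real {ω | X ω ≤ x} = P.real {ω | Y ω ≤ x} := by
    intro x
    have h1 := map_measureReal_apply (μ := P) hX (measurableSet_Iic (a := x))
    have h2 := map_measureReal_apply (μ := P) hY (measurableSet_Iic (a := x))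
    rw [h] at h1
    exact h1.symm.trans h2
  have hV : ∀ β, VaR P β X = VaR P β Y := fun β => by simp only [VaR, hF]
  simp only [ES, hV]

theorem VaR_one_convexComb_le [IsProbabilityMeasure P] {X Y : Ω → ℝ} (hX : Measurable X)
    (hY : Measurable Y) {γ : ℝ} (h0 : 0 ≤ γ)
    (h1 : γ ≤ 1) :
    VaR P 1 (γ • X + (1 - γ) • Y) ≤ max (VaR P 1 X) (VaR P 1 Y) := by
  refine EReal.le_of_forall_lt_iff_le.1 fun z hz => ?_
  obtain ⟨hzX, hzY⟩ := max_lt_iff.1 hz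
  obtain ⟨_, ⟨a, ha, rfl⟩, haz⟩ := sInf_lt_iff.1 hzX
  obtain ⟨_, ⟨b, hb, rfl⟩, hbz⟩ := sInf_lt_iff.1 hzY
  have key : ∀ {W : Ω → ℝ} {c : ℝ}, 1 ≤ P.real {ω | W ω ≤ c} → ((c : ℝ) : EReal) < z →
      1 ≤ P.real {ω | W ω ≤ z} := fun h hc =>
    h.trans (measureReal_le_mono _ (EReal.coe_lt_coe_iff.1 hc).le)
  have hae : ∀ {W : Ω → ℝ}, Measurable W → (1 ≤ P.real {ω | W ω ≤ z} ↔ ∀ᵐ ω ∂P, W ω ≤ z) := by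
    intro W hW
    rw [Filter.Eventually, mem_ae_iff_prob_eq_one (measurableSet_le hW measurable_const),
      measureReal_def, ← ENNReal.toReal_one, ENNReal.toReal_le_toReal ENNReal.one_ne_top
      (measure_ne_top _ _)]
    exact ⟨fun h => le_antisymm prob_le_one h, fun h => h.ge⟩
  refine sInf_le ⟨z, (hae ((hX.const_smul γ).add (hY.const_smul (1 - γ)))).2 ?_, rfl⟩
  filter_upwards [(hae hX).1 (key ha haz), (hae hY).1 (key hb hbz)] with ω hω hω'
  exact (convex_Iic z) hω hω' h0 (sub_nonneg.2 h1) (add_sub_cancel _ _)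

theorem integrable_positivePart [IsFiniteMeasure P] {X : Ω → ℝ} (hX : X ∈ L1 P) (t : ℝ) :
    Integrable (fun ω => max (X ω - t) 0) P :=
  (hX.2.sub (integrable_const t)).pos_part

/-- For `0 < α < 1`, insert the convex combination of the two optimal thresholds into the
Rockafellar–Uryasev bound and use convexity of the positive part. Level 0 is linearity of the mean,
level 1 the essential supremum. -/
theorem ES_convexComb_le [IsProbabilityMeasure P] {X Y : Ω → ℝ} (hX : X ∈ L1 P) (hY : Y ∈ L1 P)
    {α γ : ℝ} (hα : α ∈ Icc (0 : ℝ) 1) (h0 : 0 ≤ γ) (h1 : γ ≤ 1) :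
    ES P α (γ • X + (1 - γ) • Y) ≤ max (ES P α X) (ES P α Y) := by
  have hZ : γ • X + (1 - γ) • Y ∈ L1 P :=
    convex_L1 P hX hY h0 (sub_nonneg.2 h1) (add_sub_cancel _ _)
  rcases hα.2.eq_or_lt with rfl | hα1
  · simp only [ES_one]
    exact VaR_one_convexComb_le hX.1 hY.1 h0 h1
  have key : ∫ β in α..1, quantile P (γ • X + (1 - γ) • Y) β ≤
      γ * (∫ β in α..1, quantile P X β) + (1 - γ) * ∫ β in α..1, quantile P Y β := by
    rcases hα.1.eq_or_lt with rfl | hα0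
    · have e : ∀ {W : Ω → ℝ}, W ∈ L1 P → ∫ β in (0 : ℝ)..1, quantile P W β = ∫ ω, W ω ∂P :=
        fun hW => integral_comp_quantile hW.1 (g := fun x => x) measurable_id
      rw [e hX, e hY, e hZ]
      simp only [Pi.add_apply, Pi.smul_apply, smul_eq_mul]
      rw [integral_add (hX.2.const_mul _) (hY.2.const_mul _), integral_const_mul,
        integral_const_mul]
    · rw [integral_quantile_eq hX ⟨hα0, hα1⟩, integral_quantile_eq hY ⟨hα0, hα1⟩]
      set s := quantile P X α
      set t := quantile P Y α
      refine (integral_quantile_le hZ hα (γ * s + (1 - γ) * t)).trans ?_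
      have hmono : ∫ ω, max ((γ • X + (1 - γ) • Y) ω - (γ * s + (1 - γ) * t)) 0 ∂P ≤
          ∫ ω, (γ * max (X ω - s) 0 + (1 - γ) * max (Y ω - t) 0) ∂P := by
        refine integral_mono (integrable_positivePart hZ _)
          (((integrable_positivePart hX s).const_mul γ).add
            ((integrable_positivePart hY t).const_mul (1 - γ))) fun ω => ?_
        have e1 : γ * (X ω - s) ≤ γ * max (X ω - s) 0 :=
          mul_le_mul_of_nonneg_left (le_max_left _ _) h0
        have e2 : (1 - γ) * (Y ω - t) ≤ (1 - γ) * max (Y ω - t) 0 :=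
          mul_le_mul_of_nonneg_left (le_max_left _ _) (sub_nonneg.2 h1)
        have e3 : 0 ≤ γ * max (X ω - s) 0 := mul_nonneg h0 (le_max_right _ _)
        have e4 : 0 ≤ (1 - γ) * max (Y ω - t) 0 :=
          mul_nonneg (sub_nonneg.2 h1) (le_max_right _ _)
        refine max_le ?_ (add_nonneg e3 e4)
        simp only [Pi.add_apply, Pi.smul_apply, smul_eq_mul]
        linarith
      rw [integral_add ((integrable_positivePart hX s).const_mul γ)
        ((integrable_positivePart hY t).const_mul (1 - γ)), integral_const_mul,
        integral_const_mul] at hmono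
      linarith
  rw [ES_eq _ hα.1 hα1, ES_eq _ hα.1 hα1, ES_eq _ hα.1 hα1, ← EReal.coe_strictMono.monotone.map_max,
    EReal.coe_le_coe_iff, ← mul_max_of_nonneg _ _ (one_div_nonneg.2 (sub_nonneg.2 hα.2))]
  refine mul_le_mul_of_nonneg_left (key.trans ?_) (one_div_nonneg.2 (sub_nonneg.2 hα.2))
  exact (convex_Iic (max (∫ β in α..1, quantile P X β) (∫ β in α..1, quantile P Y β)))
    (mem_Iic.2 (le_max_left _ _)) (mem_Iic.2 (le_max_right _ _)) h0 (sub_nonneg.2 h1)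
    (add_sub_cancel _ _)

theorem ESLambda_convexComb_le [IsProbabilityMeasure P] {Λ : ℝ → ℝ}
    (hΛ : ∀ x, Λ x ∈ Icc (0 : ℝ) 1) {X Y : Ω → ℝ} (hX : X ∈ L1 P) (hY : Y ∈ L1 P)
    {γ : ℝ} (h0 : 0 ≤ γ) (h1 : γ ≤ 1) :
    ESLambda P Λ (γ • X + (1 - γ) • Y) ≤ max (ESLambda P Λ X) (ESLambda P Λ Y) := by
  refine iSup_le fun x => (min_le_min_right _ (ES_convexComb_le hX hY (hΛ x) h0 h1)).trans ?_
  rw [min_max_distrib_right]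
  exact max_le_max (le_iSup (fun x : ℝ => min (ES P (Λ x) X) (x : EReal)) x)
    (le_iSup (fun x : ℝ => min (ES P (Λ x) Y) (x : EReal)) x)

/-- The sup-min and inf-max representations agree for decreasing functions. -/
theorem iSup_min_eq_iInf_max {f : ℝ → EReal} (hf : Antitone f) :
    ⨆ x : ℝ, min (f x) (x : EReal) = ⨅ x : ℝ, max (f x) (x : EReal) := by
  refine le_antisymm (iSup_le fun x => le_iInf fun y => ?_) ?_
  · rcases le_total x y with h | h
    · exact (min_le_right _ _).trans (le_max_of_le_right (EReal.coe_le_coe_iff.2 h))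
    · exact (min_le_left _ _).trans (le_max_of_le_left (hf h))
  -- A real `z` strictly between satisfies `z < f z`, so the term of the supremum at `z` equals `z`.
  · by_contra hlt
    obtain ⟨z, hz1, hz2⟩ := EReal.lt_iff_exists_real_btwn.1 (not_le.1 hlt)
    have h1 := hz2.trans_le (iInf_le (fun x : ℝ => max (f x) (x : EReal)) z)
    have h2 := (le_iSup (fun x : ℝ => min (f x) (x : EReal)) z).trans_lt hz1
    rcases lt_max_iff.1 h1 with h | h
    · rw [min_eq_right h.le] at h2
      exact lt_irrefl _ h2
    · exact lt_irrefl _ h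

end ExpectedShortfall

/-! ### Rotations of the tail interval -/

section Rotation

/-- The map factors as projection to the circle of length `p`, a rotation there, and the lift back
to `(a, a + p]`. -/
theorem measurePreserving_toIocMod_add {p : ℝ} (hp : 0 < p) (a c : ℝ) :
    MeasurePreserving (fun u => toIocMod hp a (u + c)) (volume.restrict (Ioc a (a + p)))
      (volume.restrict (Ioc a (a + p))) := by
  have : Fact (0 < p) := ⟨hp⟩
  have h1 := AddCircle.measurePreserving_mk p a
  have h2 := measurePreserving_add_right (volume : Measure (AddCircle p)) (c : AddCircle p)
  have h3 := AddCircle.measurePreserving_equivIoc p (a := a)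
  have h4 := measurePreserving_subtype_coe (μa := (volume : Measure ℝ))
    (measurableSet_Ioc (a := a) (b := a + p))
  exact h4.comp (h3.comp (h2.comp h1))

/-- The map rotating the interval `(a, a + p]` by `c` and fixing all points up to `a`. -/
def tailRotation {p : ℝ} (hp : 0 < p) (a c u : ℝ) : ℝ :=
  if u ≤ a then u else toIocMod hp a (u + c)

theorem measurePreserving_tailRotation {p : ℝ} (hp : 0 < p) {a : ℝ} (ha : 0 ≤ a)
    (hap : a + p = 1) (c : ℝ) :
    MeasurePreserving (tailRotation hp a c) (volume.restrict (Ioc (0 : ℝ) 1))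
      (volume.restrict (Ioc (0 : ℝ) 1)) := by
  have h := measurePreserving_toIocMod_add hp a c
  rw [hap] at h
  have hm : Measurable (tailRotation hp a c) :=
    Measurable.ite measurableSet_Iic measurable_id h.measurable
  have h01 : volume.restrict (Ioc (0 : ℝ) 1) =
      volume.restrict (Ioc 0 a) + volume.restrict (Ioc a 1) := by
    rw [← Ioc_union_Ioc_eq_Ioc ha (by linarith : a ≤ 1),
      Measure.restrict_union (Ioc_disjoint_Ioc_of_le le_rfl) measurableSet_Ioc]
  refine ⟨hm, ?_⟩
  have e1 : tailRotation hp a c =ᵐ[volume.restrict (Ioc 0 a)] id := by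
    filter_upwards [ae_restrict_mem measurableSet_Ioc] with u hu
    exact if_pos hu.2
  have e2 : tailRotation hp a c =ᵐ[volume.restrict (Ioc a 1)]
      fun u => toIocMod hp a (u + c) := by
    filter_upwards [ae_restrict_mem measurableSet_Ioc] with u hu
    exact if_neg (not_le.2 hu.1)
  rw [h01, Measure.map_add _ _ hm, Measure.map_congr e1, Measure.map_congr e2, Measure.map_id,
    h.map_eq]

/-- The equispaced rotations of a point of `(a, a + p]` lie in a cyclic shift of the `n` cells. -/
theorem exists_lt_toIocMod_add {p : ℝ} (hp : 0 < p) {a u : ℝ} (hu : u ∈ Ioc a (a + p)) {n : ℕ}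
    (hn : 0 < n) :
    ∃ k : ℕ, ∀ i : ℕ, a + ((k + i) % n : ℕ) * (p / n) < toIocMod hp a (u + i * (p / n)) := by
  have hn' : (0 : ℝ) < n := Nat.cast_pos.2 hn
  have hd : 0 < p / n := div_pos hp hn'
  have hpos : 0 < (u - a) / (p / n) := div_pos (sub_pos.2 hu.1) hd
  -- Here `k` indexes the cell containing `u`; the cells are open on the left, hence the ceiling
  -- minus one.
  obtain ⟨k, hk⟩ : ∃ k : ℕ, ⌈(u - a) / (p / n)⌉₊ = k + 1 :=
    Nat.exists_eq_succ_of_ne_zero (Nat.ceil_pos.2 hpos).ne'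
  have hk1 : (k : ℝ) * (p / n) < u - a := by
    rw [← lt_div_iff₀ hd]
    exact Nat.lt_ceil.1 (by omega)
  have hk2 : u - a ≤ ((k : ℝ) + 1) * (p / n) := by
    rw [← div_le_iff₀ hd]
    have := Nat.le_ceil ((u - a) / (p / n))
    rw [hk] at this
    exact_mod_cast this
  refine ⟨k, fun i => ?_⟩
  set r := (k + i) % n
  set d := (k + i) / n
  have hr : (r : ℝ) + 1 ≤ n := by exact_mod_cast Nat.mod_lt (k + i) hn
  have hdiv : (k : ℝ) + i = r + n * d := by exact_mod_cast (Nat.mod_add_div (k + i) n).symm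
  have hnp : (n : ℝ) * (p / n) = p := by field_simp
  have e : toIocMod hp a (u + i * (p / n)) = u - k * (p / n) + r * (p / n) := by
    refine (toIocMod_eq_iff hp).2 ⟨⟨?_, ?_⟩, d, ?_⟩
    · have : 0 ≤ (r : ℝ) * (p / n) := by positivity
      linarith
    · have : ((r : ℝ) + 1) * (p / n) ≤ n * (p / n) := by gcongr
      linarith
    · rw [zsmul_eq_mul, Int.cast_natCast]
      have : ((k : ℝ) + i) * (p / n) = r * (p / n) + d * p := by
        rw [hdiv, add_mul, mul_right_comm, hnp, mul_comm p]
      linarith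
  rw [e]
  linarith

theorem sum_range_add_mod {M : Type*} [AddCommMonoid M] (b : ℕ → M) (k n : ℕ) :
    ∑ i ∈ Finset.range n, b ((k + i) % n) = ∑ j ∈ Finset.range n, b j := by
  calc ∑ i ∈ Finset.range n, b ((k + i) % n) = ∑ i ∈ Finset.Ico k (k + n), b (i % n) := by
        rw [Finset.sum_Ico_eq_sum_range, Nat.add_sub_cancel_left]
    _ = ∑ j ∈ (Finset.Ico k (k + n)).image (· % n), b j :=
        (Finset.sum_image (Nat.mod_injOn_Ico k n)).symm
    _ = ∑ j ∈ Finset.range n, b j := by rw [Nat.image_Ico_mod]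

end Rotation

/-! ### Averages of rotated copies -/

section Averages

open Filter Topology

variable {Ω : Type*} [MeasurableSpace Ω] {P : Measure Ω}

theorem tendsto_integral_quantile [IsProbabilityMeasure P] {X : Ω → ℝ} (hX : X ∈ L1 P) {α : ℝ}
    (hα : α ∈ Icc (0 : ℝ) 1) {ι : Type*} {l : Filter ι} {u : ι → ℝ} (hu : ∀ i, u i ∈ Icc α 1)
    (hlim : Tendsto u l (𝓝 1)) :
    Tendsto (fun i => ∫ β in α..u i, quantile P X β) l (𝓝 (∫ β in α..1, quantile P X β)) := by
  have h := intervalIntegral.continuousOn_primitive_interval'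
    (intervalIntegrable_quantile hX hα right_mem_unitIcc) (left_mem_uIcc)
  rw [uIcc_of_le hα.2] at h
  exact (h 1 ⟨hα.2, le_rfl⟩).tendsto.comp
    (tendsto_nhdsWithin_iff.2 ⟨hlim, Eventually.of_forall hu⟩)

/-- If the Expected Shortfall of `X` exceeds `z` and the tail quantiles are bounded below, then
some average of copies of `X` exceeds `z` outside an event of probability at most `α`. -/
theorem exists_average_measureReal_le [IsProbabilityMeasure P] (hP : Atomless P) {X : Ω → ℝ}
    (hX : X ∈ L1 P) {α : ℝ} (h0 : 0 ≤ α) (h1 : α < 1) {c : ℝ}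
    (hc : ∀ β ∈ Ioo α 1, c ≤ quantile P X β) {z : ℝ} (hz : (z : EReal) < ES P α X) :
    ∃ (m : ℕ) (Y : ℕ → Ω → ℝ), (∀ i, Measurable (Y i) ∧ P.map (Y i) = P.map X) ∧
      P.real {ω | (∑ i ∈ Finset.range (m + 1), (1 / ((m + 1 : ℕ) : ℝ)) • Y i) ω ≤ z} ≤ α := by
  obtain ⟨U, hU, hUlaw⟩ := exists_uniform hP
  obtain ⟨p, hp, hpα⟩ : ∃ p : ℝ, 0 < p ∧ α + p = 1 := ⟨1 - α, sub_pos.2 h1, by ring⟩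
  have hp' : 1 - α = p := by linarith
  rw [ES_eq X h0 h1, EReal.coe_lt_coe_iff, hp'] at hz
  have hα : α ∈ Icc (0 : ℝ) 1 := ⟨h0, h1.le⟩
  let g : ℕ → ℕ → ℝ := fun m j => α + j * (p / (m + 1 : ℕ))
  have hg_mono : ∀ m, Monotone (g m) := by
    intro m i j hij
    have : (i : ℝ) ≤ j := Nat.cast_le.2 hij
    simp only [g]
    gcongr
  have hg_zero : ∀ m, g m 0 = α := fun m => by simp [g]
  have hg_last : ∀ m, g m (m + 1) = 1 := by
    intro m
    simp only [g]
    rw [mul_div_cancel₀ _ (by positivity), hpα]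
  have hg_mem : ∀ m j, j ≤ m + 1 → g m j ∈ Icc α 1 := fun m j hj =>
    ⟨(hg_zero m).ge.trans (hg_mono m (Nat.zero_le j)), (hg_mono m hj).trans (hg_last m).le⟩
  have hg_mem' : ∀ m j, j ≤ m + 1 → g m j ∈ Icc (0 : ℝ) 1 := fun m j hj =>
    ⟨h0.trans (hg_mem m j hj).1, (hg_mem m j hj).2⟩
  -- As `m` grows, the omitted last cell shrinks and `c` gets vanishing weight, so the right side
  -- tends to `ES_α(X)`.
  obtain ⟨m, hm⟩ : ∃ m : ℕ, z < 1 / ((m + 1 : ℕ) : ℝ) *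
      (((m + 1 : ℕ) : ℝ) / p * (∫ β in α..g m m, quantile P X β) + c) := by
    have hlim0 : Tendsto (fun m : ℕ => 1 / ((m + 1 : ℕ) : ℝ)) atTop (𝓝 0) := by
      simpa using tendsto_one_div_add_atTop_nhds_zero_nat (𝕜 := ℝ)
    have hlimg : Tendsto (fun m => g m m) atTop (𝓝 1) := by
      have : ∀ m, g m m = 1 - p * (1 / ((m + 1 : ℕ) : ℝ)) := by
        intro m
        have h := hg_last m
        simp only [g] at h ⊢
        push_cast at h ⊢
        linear_combination h
      simp only [this]
      simpa using (hlim0.const_mul p).const_sub 1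
    have hlim := ((tendsto_integral_quantile hX hα
      (fun m => hg_mem m m (Nat.le_succ m)) hlimg).const_mul (1 / p)).add (hlim0.mul_const c)
    rw [zero_mul, add_zero] at hlim
    obtain ⟨m, hm⟩ := (hlim.eventually_const_lt hz).exists
    refine ⟨m, hm.trans_eq ?_⟩
    have : ((m + 1 : ℕ) : ℝ) ≠ 0 := by positivity
    field_simp
  set n := m + 1 with hn
  have hn0 : (0 : ℝ) < (n : ℕ) := by positivity
  -- On each cell `q` is bounded below by its mean over the preceding cell; the first cell has none
  -- and takes `c`.
  let b : ℕ → ℝ := fun j => Nat.casesOn j c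
    fun j => (n : ℝ) / p * ∫ β in g m j..g m (j + 1), quantile P X β
  have hb_sum : ∑ j ∈ Finset.range n, b j =
      (n : ℝ) / p * (∫ β in α..g m m, quantile P X β) + c := by
    rw [Finset.sum_range_succ', ← Finset.mul_sum,
      intervalIntegral.sum_integral_adjacent_intervals fun k hk =>
        intervalIntegrable_quantile hX (hg_mem' m k (by omega)) (hg_mem' m (k + 1) (by omega)),
      hg_zero]
    rfl
  have hb_le : ∀ j, j < n → ∀ v, g m j < v → v < 1 → b j ≤ quantile P X v := by
    intro j hj v hv hv1
    rcases j with _ | j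
    · exact hc v ⟨(hg_zero m).ge.trans_lt hv, hv1⟩
    · have hint := integral_le_mul_of_le_Ioo (f := quantile P X) (c := quantile P X v)
        (hg_mono m (Nat.le_succ j)) (intervalIntegrable_quantile hX (hg_mem' m j (by omega))
          (hg_mem' m (j + 1) (by omega))) fun β hβ => by
          have hβ0 : 0 < β := (hg_mem' m j (by omega)).1.trans_lt hβ.1
          have hβv : β < v := hβ.2.trans hv
          exact monotoneOn_quantile hX.1 ⟨hβ0, hβv.trans hv1⟩ ⟨hβ0.trans hβv, hv1⟩ hβv.le
      have hlen : g m (j + 1) - g m j = p / n := by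
        simp only [g, ← hn]
        push_cast
        ring
      rw [hlen] at hint
      calc b (j + 1) ≤ (n : ℝ) / p * (p / n * quantile P X v) := by
            simp only [b]
            gcongr
        _ = quantile P X v := by field_simp
  let S : ℕ → Ω → ℝ := fun i ω => tailRotation hp α (i * (p / n)) (U ω)
  have hS : ∀ i, MeasurePreserving (S i) P (volume.restrict (Ioc (0 : ℝ) 1)) := fun i =>
    (measurePreserving_tailRotation hp h0 hpα (i * (p / n))).comp ⟨hU, hUlaw⟩
  have hq : ∀ i, MeasurePreserving (fun ω => quantile P X (S i ω)) P (P.map X) := fun i =>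
    MeasurePreserving.comp ⟨measurable_quantile hX.1, map_quantile hX.1⟩ (hS i)
  refine ⟨m, fun i ω => quantile P X (S i ω), fun i => ⟨(hq i).measurable, (hq i).map_eq⟩, ?_⟩
  -- The endpoint 1 must be discarded: `quantile` takes the default value 0 there.
  have hS1 : ∀ᵐ ω ∂P, ∀ i, S i ω < 1 := by
    rw [ae_all_iff]
    intro i
    have h := ae_restrict_mem (μ := (volume : Measure ℝ)) (measurableSet_Ioo (a := (0 : ℝ)) (b := 1))
    rw [Measure.restrict_congr_set Ioo_ae_eq_Ioc, ← (hS i).map_eq] at h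
    filter_upwards [ae_of_ae_map (hS i).measurable.aemeasurable h] with ω hω using hω.2
  have hU1 : ∀ᵐ ω ∂P, U ω ≤ 1 := by
    have h := ae_restrict_mem (μ := (volume : Measure ℝ)) (measurableSet_Ioc (a := (0 : ℝ)) (b := 1))
    rw [← hUlaw] at h
    filter_upwards [ae_of_ae_map hU.aemeasurable h] with ω hω using hω.2
  have hUα : P.real {ω | U ω ≤ α} = α := by
    have h : P.real (U ⁻¹' Iic α) = (volume.restrict (Ioc (0 : ℝ) 1)).real (Iic α) := by
      rw [← hUlaw, map_measureReal_apply hU measurableSet_Iic]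
    refine h.trans ?_
    rw [measureReal_restrict_apply measurableSet_Iic, inter_comm, Ioc_inter_Iic, min_eq_right h1.le,
      Real.volume_real_Ioc_of_le h0, sub_zero]
  refine le_trans (ENNReal.toReal_mono (measure_ne_top _ _) (measure_mono_ae ?_)) hUα.le
  filter_upwards [hS1, hU1] with ω hω1 hω2 hωz
  by_contra hlt
  have hUω : U ω ∈ Ioc α (α + p) := ⟨not_le.1 hlt, hω2.trans_eq hpα.symm⟩
  obtain ⟨k, hk⟩ := exists_lt_toIocMod_add hp hUω (n := n) (by omega)
  have hle : ∑ i ∈ Finset.range n, b ((k + i) % n) ≤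
      ∑ i ∈ Finset.range n, quantile P X (S i ω) := by
    refine Finset.sum_le_sum fun i _ => hb_le _ (Nat.mod_lt _ (by omega)) _ ?_ (hω1 i)
    have : S i ω = toIocMod hp α (U ω + i * (p / n)) := if_neg hlt
    rw [this]
    exact hk i
  rw [sum_range_add_mod, hb_sum] at hle
  have hωz' : ∑ i ∈ Finset.range n, 1 / (n : ℝ) * quantile P X (S i ω) ≤ z := by
    have h : (∑ i ∈ Finset.range n, (1 / (n : ℝ)) • fun ω => quantile P X (S i ω)) ω ≤ z := hωz
    simpa only [Finset.sum_apply, Pi.smul_apply, smul_eq_mul] using h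
  rw [← Finset.mul_sum] at hωz'
  exact absurd (hm.trans_le ((mul_le_mul_of_nonneg_left hle (by positivity)).trans hωz'))
    (lt_irrefl _)

end Averages

/-! ### Minimality among dominating risk measures -/

section Minimality

open Filter Topology

variable {Ω : Type*} [MeasurableSpace Ω] {P : Measure Ω}

theorem mem_L1_of_map_eq {X Y : Ω → ℝ} (hX : X ∈ L1 P) (hY : Measurable Y)
    (h : P.map Y = P.map X) : Y ∈ L1 P := by
  refine ⟨hY, ?_⟩
  have h1 : Integrable id (P.map X) :=
    (integrable_map_measure measurable_id.aestronglyMeasurable hX.1.aemeasurable).2 hX.2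
  rw [← h] at h1
  exact (integrable_map_measure measurable_id.aestronglyMeasurable hY.aemeasurable).1 h1

theorem mem_L1Below_of_map_eq {X Y : Ω → ℝ} (hX : X ∈ L1Below P) (hY : Measurable Y)
    (h : P.map Y = P.map X) : Y ∈ L1Below P := by
  refine ⟨mem_L1_of_map_eq hX.1 hY h, ?_⟩
  obtain ⟨c, hc⟩ := hX.2
  refine ⟨c, ?_⟩
  have h1 : ∀ᵐ x ∂(P.map X), c ≤ x := (ae_map_iff hX.1.1.aemeasurable measurableSet_Ici).2 hc
  rw [← h] at h1
  exact ae_of_ae_map hY.aemeasurable h1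

/-- A quasi-convex law-invariant map does not increase under averaging of copies. -/
theorem QuasiConvex.average_le {𝒳 : Set (Ω → ℝ)} (hconv : Convex ℝ 𝒳) {ρ : 𝒳 → EReal}
    (hq : QuasiConvex ρ) (hl : LawInvariant P ρ) (X : 𝒳) {Y : ℕ → Ω → ℝ}
    (hY : ∀ i, ∃ _ : Y i ∈ 𝒳, P.map (Y i) = P.map (X : Ω → ℝ)) (m : ℕ) :
    ∃ h : ∑ i ∈ Finset.range (m + 1), (1 / ((m + 1 : ℕ) : ℝ)) • Y i ∈ 𝒳, ρ ⟨_, h⟩ ≤ ρ X := by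
  have hC : Convex ℝ {Z : Ω → ℝ | ∃ h : Z ∈ 𝒳, ρ ⟨Z, h⟩ ≤ ρ X} := by
    rintro V ⟨hV, hVρ⟩ W ⟨hW, hWρ⟩ a b ha hb hab
    obtain rfl : b = 1 - a := by linarith
    have hmem := hconv hV hW ha hb hab
    exact ⟨hmem, (hq ⟨V, hV⟩ ⟨W, hW⟩ a ha (by linarith) hmem).trans (max_le hVρ hWρ)⟩
  refine hC.sum_mem (fun _ _ => by positivity) ?_ fun i _ => ?_
  · rw [Finset.sum_const, Finset.card_range, nsmul_eq_mul]
    exact mul_one_div_cancel (by positivity)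
  · obtain ⟨h, hlaw⟩ := hY i
    exact ⟨h, (hl ⟨Y i, h⟩ X hlaw).le⟩

/-- Left continuity of `ES` in its level. Lowering the level turns `P(Z ≤ z) ≤ α'` into the strict
inequality that `VaR_Λ` requires. -/
theorem exists_lt_ES_of_lt [IsProbabilityMeasure P] {X : Ω → ℝ} (hX : X ∈ L1 P) {α z : ℝ}
    (h0 : 0 < α) (h1 : α < 1) (hz : (z : EReal) < ES P α X) :
    ∃ α' ∈ Ioo 0 α, (z : EReal) < ES P α' X := by
  rw [ES_eq X h0.le h1, EReal.coe_lt_coe_iff] at hz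
  have hc : Tendsto (fun a => 1 / (1 - a) * ∫ β in a..1, quantile P X β) (𝓝[<] α)
      (𝓝 (1 / (1 - α) * ∫ β in α..1, quantile P X β)) := by
    have m0 : (0 : ℝ) ∈ Icc (0 : ℝ) 1 := ⟨le_rfl, zero_le_one⟩
    have h := intervalIntegral.continuousOn_primitive_interval'
      (intervalIntegrable_quantile hX m0 right_mem_unitIcc) (right_mem_uIcc)
    rw [uIcc_of_le zero_le_one] at h
    have hint := ((h.continuousAt (Icc_mem_nhds h0 h1)).tendsto.mono_left
      (nhdsWithin_le_nhds (s := Iio α))).neg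
    simp only [← intervalIntegral.integral_symm] at hint
    refine Tendsto.mul ?_ hint
    have : ContinuousAt (fun a : ℝ => 1 / (1 - a)) α :=
      continuousAt_const.div (continuousAt_const.sub continuousAt_id) (sub_ne_zero.2 h1.ne')
    exact this.tendsto.mono_left nhdsWithin_le_nhds
  obtain ⟨a, ha, hα⟩ := ((hc.eventually_const_lt hz).and (Ioo_mem_nhdsLT h0)).exists
  refine ⟨a, hα, ?_⟩
  rwa [ES_eq X hα.1.le (hα.2.trans h1), EReal.coe_lt_coe_iff]

/-- A lower bound criterion for the generalized quantile `VaR_Λ`. -/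
theorem le_VaRLambda [IsFiniteMeasure P] {Λ : ℝ → ℝ} (hΛ : Antitone Λ) {X : Ω → ℝ} {x z : ℝ}
    (hzx : z ≤ x) (h : P.real {ω | X ω ≤ z} < Λ x) : (z : EReal) ≤ VaRLambda P Λ X := by
  refine le_sInf ?_
  rintro _ ⟨y, hy, rfl⟩
  rw [EReal.coe_le_coe_iff]
  by_contra hlt
  have hyz := (not_le.1 hlt).le
  exact absurd ((hΛ (hyz.trans hzx)).trans (le_trans hy (measureReal_le_mono X hyz))) (not_le.2 h)

/-- A lower bound criterion for the generalized quantile `VaR⁺_Λ`. -/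
theorem le_VaRPlusLambda [IsFiniteMeasure P] {Λ : ℝ → ℝ} (hΛ : Antitone Λ) {X : Ω → ℝ} {x z : ℝ}
    (hzx : z ≤ x) (h : P.real {ω | X ω ≤ z} ≤ Λ x) : (z : EReal) ≤ VaRPlusLambda P Λ X := by
  refine le_sInf ?_
  rintro _ ⟨y, hy, rfl⟩
  rw [EReal.coe_le_coe_iff]
  by_contra hlt
  have hyz := (not_le.1 hlt).le
  exact absurd (((measureReal_le_mono X hyz).trans h).trans (hΛ (hyz.trans hzx))) (not_le.2 hy)

theorem VaRLambda_le_VaRPlusLambda (Λ : ℝ → ℝ) (X : Ω → ℝ) :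
    VaRLambda P Λ X ≤ VaRPlusLambda P Λ X :=
  sInf_le_sInf (image_mono (ofPred_subset_ofPred.2 fun _ hx => hx.le))

theorem dominatingRiskMeasures_anti {𝒳 : Set (Ω → ℝ)} {τ τ' : (Ω → ℝ) → EReal}
    (h : ∀ X, τ X ≤ τ' X) :
    DominatingRiskMeasures P 𝒳 τ' ⊆ DominatingRiskMeasures P 𝒳 τ :=
  fun _ hρ => ⟨fun X => (h X).trans (hρ.1 X), hρ.2⟩

theorem ESLambda_le_of_mem_dominating [IsProbabilityMeasure P] (hP : Atomless P) {Λ : ℝ → ℝ}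
    (hΛ : Antitone Λ) (hΛ01 : ∀ x, Λ x ∈ Ioc (0 : ℝ) 1) {ρ : L1 P → EReal}
    (hρ : ρ ∈ DominatingRiskMeasures P (L1 P) (VaRLambda P Λ)) (X : L1 P) :
    ESLambda P Λ X ≤ ρ X := by
  obtain ⟨hdom, hq, hl⟩ := hρ
  refine EReal.ge_of_forall_gt_iff_ge.1 fun z hz => ?_
  obtain ⟨x, hx⟩ := lt_iSup_iff.1 hz
  obtain ⟨hES, hzx⟩ := lt_min_iff.1 hx
  have hzx := (EReal.coe_lt_coe_iff.1 hzx).le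
  rcases (hΛ01 x).2.eq_or_lt with h1 | h1
  -- At level 1 no averaging is needed: `z < VaR_1(X)` already gives `P(X ≤ z) < 1`.
  · refine le_trans (le_VaRLambda hΛ hzx ?_) (hdom X)
    rw [h1]
    rw [h1, ES_one] at hES
    by_contra hlt
    have hle : VaR P 1 X ≤ z := sInf_le ⟨z, not_lt.1 hlt, rfl⟩
    exact absurd hle (not_le.2 hES)
  · obtain ⟨α, hα, hESα⟩ := exists_lt_ES_of_lt X.2 (hΛ01 x).1 h1 hES
    have hα1 := hα.2.trans h1
    obtain ⟨m, Y, hY, hYz⟩ := exists_average_measureReal_le hP X.2 hα.1.le hα1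
      -- As `α > 0`, the quantile at `α` is a finite lower bound for the tail.
      (fun β hβ => monotoneOn_quantile X.2.1 ⟨hα.1, hα1⟩ ⟨hα.1.trans hβ.1, hβ.2⟩ hβ.1.le) hESα
    obtain ⟨h, hle⟩ := hq.average_le (convex_L1 P) hl X
      (fun i => ⟨mem_L1_of_map_eq X.2 (hY i).1 (hY i).2, (hY i).2⟩) m
    exact (le_VaRLambda hΛ hzx (hYz.trans_lt hα.2)).trans ((hdom ⟨_, h⟩).trans hle)

theorem le_quantile_of_ae_le [IsProbabilityMeasure P] {X : Ω → ℝ} (hX : Measurable X) {c : ℝ}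
    (hc : ∀ᵐ ω ∂P, c ≤ X ω) {β : ℝ} (hβ : β ∈ Ioo (0 : ℝ) 1) : c ≤ quantile P X β := by
  by_contra hlt
  have h1 := (quantile_le_iff (P := P) hX hβ).1 le_rfl
  have h2 : P {ω | X ω ≤ quantile P X β} = 0 := by
    refine measure_mono_null (fun ω hω => ?_) (ae_iff.1 hc)
    exact not_le.2 (lt_of_le_of_lt hω (not_le.1 hlt))
  rw [measureReal_def, h2, ENNReal.toReal_zero] at h1
  exact absurd h1 (not_le.2 hβ.1)

theorem ESLambda_le_of_mem_dominating_below [IsProbabilityMeasure P] (hP : Atomless P)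
    {Λ : ℝ → ℝ} (hΛ : Antitone Λ) (hΛ01 : ∀ x, Λ x ∈ Ico (0 : ℝ) 1) {ρ : L1Below P → EReal}
    (hρ : ρ ∈ DominatingRiskMeasures P (L1Below P) (VaRPlusLambda P Λ)) (X : L1Below P) :
    ESLambda P Λ X ≤ ρ X := by
  obtain ⟨hdom, hq, hl⟩ := hρ
  refine EReal.ge_of_forall_gt_iff_ge.1 fun z hz => ?_
  obtain ⟨x, hx⟩ := lt_iSup_iff.1 hz
  obtain ⟨hES, hzx⟩ := lt_min_iff.1 hx
  have hzx := (EReal.coe_lt_coe_iff.1 hzx).le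
  obtain ⟨c, hc⟩ := X.2.2
  obtain ⟨m, Y, hY, hYz⟩ := exists_average_measureReal_le hP X.2.1 (hΛ01 x).1 (hΛ01 x).2
    (fun β hβ => le_quantile_of_ae_le X.2.1.1 hc ⟨(hΛ01 x).1.trans_lt hβ.1, hβ.2⟩) hES
  obtain ⟨h, hle⟩ := hq.average_le (convex_L1Below P) hl X
    (fun i => ⟨mem_L1Below_of_map_eq X.2 (hY i).1 (hY i).2, (hY i).2⟩) m
  exact (le_VaRPlusLambda hΛ hzx hYz).trans ((hdom ⟨_, h⟩).trans hle)

theorem ESLambda_mem_dominating [IsProbabilityMeasure P] {Λ : ℝ → ℝ}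
    (hΛ : ∀ x, Λ x ∈ Icc (0 : ℝ) 1) {𝒳 : Set (Ω → ℝ)} (h𝒳 : 𝒳 ⊆ L1 P) {τ : (Ω → ℝ) → EReal}
    (hτ : ∀ X ∈ L1 P, τ X ≤ ESLambda P Λ X) :
    (fun X : 𝒳 => ESLambda P Λ X) ∈ DominatingRiskMeasures P 𝒳 τ := by
  refine ⟨fun X => hτ X (h𝒳 X.2), fun X Y γ h0 h1 h =>
    ESLambda_convexComb_le hΛ (h𝒳 X.2) (h𝒳 Y.2) h0 h1, fun X Y h => ?_⟩
  simp only [ESLambda, ES_congr_of_map_eq (h𝒳 X.2).1 (h𝒳 Y.2).1 h]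

end Minimality

end LambdaES

end

theorem theorem6p3 {Ω : Type*} [MeasurableSpace Ω] (P : Measure Ω) [IsProbabilityMeasure P]
    (hP : LambdaES.Atomless P) :
    (∀ Λ : ℝ → ℝ, Antitone Λ → (∀ x, Λ x ∈ Ioc (0 : ℝ) 1) →
      IsLeast (LambdaES.DominatingRiskMeasures P (LambdaES.L1 P) (LambdaES.VaRLambda P Λ))
        (fun X => LambdaES.ESLambda P Λ X)) ∧
    (∀ Λ : ℝ → ℝ, Antitone Λ → (∀ x, Λ x ∈ Ioo (0 : ℝ) 1) →
      IsLeast (LambdaES.DominatingRiskMeasures P (LambdaES.L1 P) (LambdaES.VaRPlusLambda P Λ))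
        (fun X => LambdaES.ESLambda P Λ X)) ∧
    (∀ Λ : ℝ → ℝ, Antitone Λ → (∀ x, Λ x ∈ Ico (0 : ℝ) 1) →
      IsLeast (LambdaES.DominatingRiskMeasures P (LambdaES.L1Below P) (LambdaES.VaRPlusLambda P Λ))
        (fun X => LambdaES.ESLambda P Λ X)) ∧
    (∀ Λ : ℝ → ℝ, Antitone Λ → (∀ x, Λ x ∈ Icc (0 : ℝ) 1) →
      ∀ X ∈ LambdaES.L1 P,
        LambdaES.ESLambda P Λ X = ⨅ x : ℝ, max (LambdaES.ES P (Λ x) X) (x : EReal)) := by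
  refine ⟨fun Λ hΛ h => ⟨?_, ?_⟩, fun Λ hΛ h => ⟨?_, ?_⟩, fun Λ hΛ h => ⟨?_, ?_⟩,
    fun Λ hΛ h X hX => ?_⟩
  · have h' := fun x => Ioc_subset_Icc_self (h x)
    exact LambdaES.ESLambda_mem_dominating h' Subset.rfl
      fun X hX => LambdaES.VaRLambda_le_ESLambda h' hX
  · exact fun ρ hρ X => LambdaES.ESLambda_le_of_mem_dominating hP hΛ h hρ X
  · exact LambdaES.ESLambda_mem_dominating (fun x => Ioo_subset_Icc_self (h x)) Subset.rfl
      fun X hX => LambdaES.VaRPlusLambda_le_ESLambda (fun x => Ioo_subset_Ico_self (h x)) hX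
  -- Dominating `VaR⁺_Λ` entails dominating `VaR_Λ`, so minimality is inherited from the first
  -- statement.
  · exact fun ρ hρ X => LambdaES.ESLambda_le_of_mem_dominating hP hΛ
      (fun x => Ioo_subset_Ioc_self (h x))
      (LambdaES.dominatingRiskMeasures_anti (LambdaES.VaRLambda_le_VaRPlusLambda Λ) hρ) X
  · exact LambdaES.ESLambda_mem_dominating (fun x => Ico_subset_Icc_self (h x))
      (fun X hX => hX.1) fun X hX => LambdaES.VaRPlusLambda_le_ESLambda h hX
  · exact fun ρ hρ X => LambdaES.ESLambda_le_of_mem_dominating_below hP hΛ h hρ X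
  · exact LambdaES.iSup_min_eq_iInf_max (f := fun x => LambdaES.ES P (Λ x) X)
      fun x y hxy => LambdaES.ES_mono hX (h y).1 (hΛ hxy) (h x).2
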